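/- Let $F_1,F_2,F_3$ be a frame of left-invariant vector fields on $\mathrm{SU}(2)$ with $[F_2,F_3]=-2F_1$, $[F_3,F_1]=-2F_2$, $[F_1,F_2]=-2F_3$ (a Milnor frame), let $\omega^1,\omega^2,\omega^3$ be the dual coframe, and let $g_0=A_0\,\omega^1\otimes\omega^1+B_0\,\omega^2\otimes\omega^2+C_0\,\omega^3\otimes\omega^3$ be a left-invariant Riemannian metric ($A_0,B_0,C_0>0$) with $B_0=C_0$. For a Riemannian metric $g$ on $\mathrm{SU}(2)$ let $$C(g)=\int_{\mathrm{SU}(2)}|C_2|_g\,d\mu_g,\qquad C_{ij}=g_{ik}\varepsilon^{klm}\Bigl(\nabla_lR_{mj}-\tfrac14\nabla_lR\,g_{mj}\Bigr),$$ be the $L^1$-norm of the Cotton–York tensor $C_2=(C_{ij})$, where $\nabla$, $R_{ij}$, $R$, $\varepsilon$ are the Levi-Civita connection, the Ricci tensor, the scalar curvature and the volume tensor of $g$. Then there are a finite $T>0$ and a maximal solution $g(t)$, $0\le t<T$, of the Ricci flow $\partial_t g=-2\,\mathrm{Ric}_g$ with $g(0)=g_0$ consisting of left-invariant metrics (it cannot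 be extended as a Ricci flow beyond $T$); every solution starting at $g_0$ and consisting of left-invariant metrics is a restriction of it, and it has the form $g(t)=A(t)\,\omega^1\otimes\omega^1+B(t)\,(\omega^2\otimes\omega^2+\omega^3\otimes\omega^3)$. Along it: 1. If $A_0/B_0<1/2$, there is exactly one time $t_0\in[0,T)$ with $A(t_0)/B(t_0)=1/2$; one has $t_0>0$, the function $t\mapsto C(g(t))$ has a local extremum at $t_0$ and at no other point of $(0,T)$, and $C(g(t))\to0$ as $t\nearrow T$. 2. If $1/2\le A_0/B_0<1$ or $A_0/B_0>1$, then $t\mapsto C(g(t))$ is strictly decreasing on $[0,T)$ and $C(g(t))\to0$ as $t\nearrow T$. 3. If $A_0=B_0$, then $C(g(t))=0$ for all $t\in[0,T)$. -/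

import Mathlib

open scoped BigOperators Topology ContDiff

noncomputable section

namespace CottonFlow

/-- The group `SU(2)`. -/
abbrev SU2 : Type := Matrix.specialUnitaryGroup (Fin 2) ℂ

/-- The Lie algebra `su(2)` of skew-Hermitian traceless matrices. An element `X` is identified with
the left-invariant vector field `x ↦ x * X` on `SU(2)`. -/
def su2 : Submodule ℝ (Matrix (Fin 2) (Fin 2) ℂ) where
  carrier := {X | X.conjTranspose = -X ∧ X.trace = 0}
  add_mem' := by
    rintro X Y ⟨hX, hX'⟩ ⟨hY, hY'⟩
    refine ⟨?_, ?_⟩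
    · rw [Matrix.conjTranspose_add, hX, hY]; abel
    · rw [Matrix.trace_add, hX', hY', add_zero]
  zero_mem' := by simp
  smul_mem' := by
    rintro c X ⟨hX, hX'⟩
    refine ⟨?_, ?_⟩
    · rw [Matrix.conjTranspose_smul, hX]; simp
    · rw [Matrix.trace_smul, hX', smul_zero]

theorem commutator_mem_su2 (X Y : su2) : X.1 * Y.1 - Y.1 * X.1 ∈ su2 := by
  have hX : X.1.conjTranspose = -X.1 := X.2.1
  have hY : Y.1.conjTranspose = -Y.1 := Y.2.1
  refine ⟨?_, ?_⟩
  · rw [Matrix.conjTranspose_sub, Matrix.conjTranspose_mul, Matrix.conjTranspose_mul, hX, hY]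
    simp
  · rw [Matrix.trace_sub, Matrix.trace_mul_comm X.1 Y.1, sub_self]

/-- The Lie bracket, which for left-invariant vector fields is the commutator of matrices. -/
instance : Bracket su2 su2 := ⟨fun X Y => ⟨X.1 * Y.1 - Y.1 * X.1, commutator_mem_su2 X Y⟩⟩

theorem exp_mem_SU2 (X : su2) :
    NormedSpace.exp (X : Matrix (Fin 2) (Fin 2) ℂ) ∈ Matrix.specialUnitaryGroup (Fin 2) ℂ := by
  obtain ⟨X, hX, hX'⟩ := X
  simp only
  have hinv : NormedSpace.exp X * NormedSpace.exp (-X) = 1 := by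
    rw [← Matrix.exp_add_of_commute _ _ (Commute.neg_right (Commute.refl X)), add_neg_cancel,
      NormedSpace.exp_zero]
  rw [Matrix.mem_specialUnitaryGroup_iff, Matrix.mem_unitaryGroup_iff]
  refine ⟨?_, ?_⟩
  · rw [Matrix.star_eq_conjTranspose, ← Matrix.exp_conjTranspose, hX, hinv]
  · -- for trace-free `X` one has `J * Xᵀ * J⁻¹ = -X`, hence `adjugate (exp X) = exp (-X)`
    set J : Matrix (Fin 2) (Fin 2) ℂ := !![0, 1; -1, 0] with hJ
    have hJdet : IsUnit J := by
      rw [Matrix.isUnit_iff_isUnit_det]; simp [hJ, Matrix.det_fin_two]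
    have hJinv : J⁻¹ = -J := by
      apply Matrix.inv_eq_right_inv
      ext i j; fin_cases i <;> fin_cases j <;> simp [hJ, Matrix.mul_apply, Fin.sum_univ_two]
    have key : ∀ M : Matrix (Fin 2) (Fin 2) ℂ, J * M.transpose * J⁻¹ = M.adjugate := by
      intro M
      rw [hJinv]
      ext i j
      fin_cases i <;> fin_cases j <;>
        simp [hJ, Matrix.mul_apply, Matrix.vecMul, dotProduct, Fin.sum_univ_two,
          Matrix.adjugate_fin_two]
    have hadj : X.adjugate = -X := by
      rw [Matrix.trace_fin_two] at hX'
      ext i j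
      fin_cases i <;> fin_cases j <;> simp [Matrix.adjugate_fin_two]
      · linear_combination hX'
      · linear_combination hX'
    have h1 : NormedSpace.exp (-X) = (NormedSpace.exp X).adjugate := by
      rw [← key, ← Matrix.exp_transpose, ← Matrix.exp_conj _ _ hJdet, key, hadj]
    have h2 := hinv
    rw [h1, Matrix.mul_adjugate] at h2
    have h3 := congrFun (congrFun h2 0) 0
    simpa using h3

/-- The exponential map `su(2) → SU(2)`. -/
def expSU2 (X : su2) : SU2 := ⟨NormedSpace.exp (X : Matrix (Fin 2) (Fin 2) ℂ), exp_mem_SU2 X⟩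

/-- The derivative of `f` along the left-invariant vector field `X`, whose flow is
`x ↦ x * exp (s X)`. -/
def lieDeriv (X : su2) (f : SU2 → ℝ) (x : SU2) : ℝ :=
  deriv (fun s : ℝ => f (x * expSU2 (s • X))) 0

/-- A smooth Riemannian metric on `SU(2)`. The tangent space at `x` is `{x * X | X ∈ su(2)}`, and
`form x X Y` is the inner product of the tangent vectors `x * X` and `x * Y`. Smoothness on the
closed submanifold `SU(2)` of the space of matrices is the existence of a smooth extension. -/
@[ext]
structure RiemannianMetric where
  form : SU2 → LinearMap.BilinForm ℝ su2
  symm : ∀ x X Y, form x X Y = form x Y X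
  pos : ∀ x X, X ≠ 0 → 0 < form x X X
  smooth : ∀ X Y, ∃ f : (Fin 2 → Fin 2 → ℂ) → ℝ, ContDiff ℝ ∞ f ∧
    ∀ x : SU2, form x X Y = f (fun i j => (x : Matrix (Fin 2) (Fin 2) ℂ) i j)

/-- Invariance under left translations: `x * X` is moved by `y` to `(y * x) * X`. -/
def RiemannianMetric.LeftInvariant (g : RiemannianMetric) : Prop :=
  ∀ y x X Y, g.form (y * x) X Y = g.form x X Y

/-- A global frame of left-invariant vector fields. -/
abbrev Frame : Type := Module.Basis (Fin 3) ℝ su2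

/-- `[F₂,F₃] = -2 F₁`, `[F₃,F₁] = -2 F₂`, `[F₁,F₂] = -2 F₃` (indices shifted by one). -/
def Frame.IsMilnor (F : Frame) : Prop :=
  ⁅F 1, F 2⁆ = (-2 : ℝ) • F 0 ∧ ⁅F 2, F 0⁆ = (-2 : ℝ) • F 1 ∧ ⁅F 0, F 1⁆ = (-2 : ℝ) • F 2

/-- `g = a ω¹ ⊗ ω¹ + b ω² ⊗ ω² + c ω³ ⊗ ω³`, where `ω` is the coframe dual to `F`. -/
def RiemannianMetric.IsDiagonal (g : RiemannianMetric) (F : Frame) (a b c : ℝ) : Prop :=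
  ∀ x i j, g.form x (F i) (F j) = Matrix.diagonal ![a, b, c] i j

/-! ### Tensor calculus in the frame `F` -/

section Tensors

variable (F : Frame) (g : RiemannianMetric)

/-- `[F i, F j] = ∑ k, structConst F i j k • F k`. -/
def structConst (i j k : Fin 3) : ℝ := F.repr ⁅F i, F j⁆ k

/-- The components `g_{ij}`. -/
def gram (x : SU2) : Matrix (Fin 3) (Fin 3) ℝ := Matrix.of fun i j => g.form x (F i) (F j)

/-- The components `g^{ij}`. -/
def gramInv (x : SU2) : Matrix (Fin 3) (Fin 3) ℝ := (gram F g x)⁻¹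

/-- `g (∇_{F i} F j, F k)`, with `∇` the Levi-Civita connection, by the Koszul formula. -/
def koszul (i j k : Fin 3) (x : SU2) : ℝ :=
  (1 / 2) * (lieDeriv (F i) (fun y => g.form y (F j) (F k)) x
    + lieDeriv (F j) (fun y => g.form y (F i) (F k)) x
    - lieDeriv (F k) (fun y => g.form y (F i) (F j)) x
    + g.form x ⁅F i, F j⁆ (F k) - g.form x ⁅F i, F k⁆ (F j) - g.form x ⁅F j, F k⁆ (F i))

/-- `∇_{F i} F j = ∑ k, christoffel F g i j k • F k`. -/
def christoffel (i j k : Fin 3) (x : SU2) : ℝ := ∑ l, gramInv F g x k l * koszul F g i j l x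

/-- `R(F i, F j) F k = ∑ l, riemann F g i j k l • F l`, where
`R(X, Y) Z = ∇_X ∇_Y Z - ∇_Y ∇_X Z - ∇_{[X, Y]} Z`. -/
def riemann (i j k l : Fin 3) (x : SU2) : ℝ :=
  lieDeriv (F i) (christoffel F g j k l) x - lieDeriv (F j) (christoffel F g i k l) x
    + ∑ m, (christoffel F g j k m x * christoffel F g i m l x
      - christoffel F g i k m x * christoffel F g j m l x
      - structConst F i j m * christoffel F g m k l x)

/-- The Ricci tensor `R_{jk}`, the trace of `X ↦ R(X, F j) F k`. -/
def ricci (j k : Fin 3) (x : SU2) : ℝ := ∑ i, riemann F g i j k i x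

/-- The scalar curvature. -/
def scalarCurv (x : SU2) : ℝ := ∑ i, ∑ j, gramInv F g x i j * ricci F g i j x

/-- `∇_l R_{mj}`. -/
def nablaRicci (l m j : Fin 3) (x : SU2) : ℝ :=
  lieDeriv (F l) (ricci F g m j) x
    - ∑ p, (christoffel F g l m p x * ricci F g p j x + christoffel F g l j p x * ricci F g m p x)

/-- The totally antisymmetric symbol `η^{klm}` with value `1` at the indices `0, 1, 2`. -/
def eta (k l m : Fin 3) : ℝ :=
  ((l.val : ℝ) - k.val) * ((m.val : ℝ) - l.val) * ((m.val : ℝ) - k.val) / 2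

/-- The Cotton–York tensor
`C_{ij} = g_{ik} ε^{klm} (∇_l R_{mj} - (1/4) ∇_l R g_{mj})`, `ε^{klm} = η^{klm} / √(det g)`. -/
def cottonYork (i j : Fin 3) (x : SU2) : ℝ :=
  ∑ k, ∑ l, ∑ m, gram F g x i k * (eta k l m / √(gram F g x).det) *
    (nablaRicci F g l m j x - (1 / 4) * lieDeriv (F l) (scalarCurv F g) x * gram F g x m j)

/-- The pointwise norm `|C₂|_g = (g^{ip} g^{jq} C_{ij} C_{pq})^{1/2}`. -/
def cottonYorkNorm (x : SU2) : ℝ :=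
  √(∑ i, ∑ j, ∑ p, ∑ q, gramInv F g x i p * gramInv F g x j q *
    cottonYork F g i j x * cottonYork F g p q x)

end Tensors

/-! ### Integration over `SU(2)` -/

/-- The unit sphere `S³` of `ℝ⁴`. -/
abbrev S3 : Type := Metric.sphere (0 : EuclideanSpace ℝ (Fin 4)) 1

/-- The matrix of a point of `ℝ⁴`. -/
def quatMatrix (v : EuclideanSpace ℝ (Fin 4)) : Matrix (Fin 2) (Fin 2) ℂ :=
  !![⟨v 0, v 1⟩, ⟨v 2, v 3⟩; ⟨-v 2, v 3⟩, ⟨v 0, -v 1⟩]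

theorem quatMatrix_mem (p : S3) :
    quatMatrix p.1 ∈ Matrix.specialUnitaryGroup (Fin 2) ℂ := by
  obtain ⟨v, hv⟩ := p
  have h : v 0 ^ 2 + v 1 ^ 2 + v 2 ^ 2 + v 3 ^ 2 = 1 := by
    have h1 : ‖v‖ = 1 := by simpa using hv
    have h2 := EuclideanSpace.norm_sq_eq v
    rw [h1, Fin.sum_univ_four] at h2
    simp only [Real.norm_eq_abs, sq_abs] at h2
    linarith
  rw [Matrix.mem_specialUnitaryGroup_iff, Matrix.mem_unitaryGroup_iff]
  refine ⟨?_, ?_⟩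
  · ext i j
    fin_cases i <;> fin_cases j <;>
      simp [quatMatrix, Matrix.mul_apply, Fin.sum_univ_two, Complex.ext_iff] <;>
      first
        | exact ⟨by linear_combination h, by ring⟩
        | exact ⟨by ring, by ring⟩
  · simp [quatMatrix, Matrix.det_fin_two, Complex.ext_iff]
    exact ⟨by linear_combination h, by ring⟩

/-- The standard identification of `S³` with `SU(2)`. -/
def sphereToSU2 (p : S3) : SU2 := ⟨quatMatrix p.1, quatMatrix_mem p⟩

/-- The round metric on `su(2)`: the one for which `sphereToSU2` is an isometry. -/
def roundInner (X Y : su2) : ℝ :=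
  (1 / 2) * ((X : Matrix (Fin 2) (Fin 2) ℂ) *
    (Y : Matrix (Fin 2) (Fin 2) ℂ).conjTranspose).trace.re

/-- The density of the Riemannian volume `dμ_g` with respect to that of the round metric. -/
def volDensity (F : Frame) (g : RiemannianMetric) (x : SU2) : ℝ :=
  √((gram F g x).det / (Matrix.of fun i j => roundInner (F i) (F j)).det)

/-- The `L¹`-norm `C(g) = ∫ |C₂|_g dμ_g` of the Cotton–York tensor. -/
def cottonL1 (F : Frame) (g : RiemannianMetric) : ℝ :=
  ∫ p : S3, cottonYorkNorm F g (sphereToSU2 p) * volDensity F g (sphereToSU2 p)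
    ∂(MeasureTheory.volume : MeasureTheory.Measure (EuclideanSpace ℝ (Fin 4))).toSphere

/-! ### The Ricci flow -/

/-- `g(t)`, `0 ≤ t < T`, is a smooth family of Riemannian metrics on `SU(2)` that solves
`∂g/∂t = -2 Ric`. -/
structure IsRicciFlow (F : Frame) (T : ℝ) (g : ℝ → RiemannianMetric) : Prop where
  smooth : ∀ X Y, ∃ f : ℝ × (Fin 2 → Fin 2 → ℂ) → ℝ,
    ContDiffOn ℝ ∞ f (Set.Ico 0 T ×ˢ Set.univ) ∧ ∀ t ∈ Set.Ico 0 T, ∀ x : SU2,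
      (g t).form x X Y = f (t, fun i j => (x : Matrix (Fin 2) (Fin 2) ℂ) i j)
  evolution : ∀ t ∈ Set.Ico 0 T, ∀ x i j,
    HasDerivWithinAt (fun s => (g s).form x (F i) (F j)) (-2 * ricci F (g t) i j x)
      (Set.Ico 0 T) t

/-- A Ricci flow on `[0, T)` that is not the restriction of one on a longer interval. -/
def IsMaximalRicciFlow (F : Frame) (T : ℝ) (g : ℝ → RiemannianMetric) : Prop :=
  IsRicciFlow F T g ∧
    ∀ T' > T, ∀ g' : ℝ → RiemannianMetric, IsRicciFlow F T' g' →
      ¬ ∀ t ∈ Set.Ico 0 T, g' t = g t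

end CottonFlow

end

noncomputable section

namespace CottonFlow

/-! ### Curvature of left-invariant metrics -/

/-! On left-invariant metrics all tensor components are constant, so the Ricci flow is an ordinary
differential equation for the Gram matrix, with unique solutions because the Ricci field is `C¹`
where the determinant is nonzero. For a Berger metric with coefficients `A, B, B` and ratio `r = A /
B` it reads `A' = -4 r²`, `B' = -8 + 4 r`.

The quantity `σ = (1 - r) / A²` is conserved. Hence `r = 1 - σ A²`, and everything reduces to the
scalar equation `A' = -4 (1 - σ A²)²`, whose solution decreases strictly to `0` in finite time `T`
(`exists_berger_profile`). A Ricci flow beyond `T` would have a degenerate metric at `T`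
(`not_isRicciFlow_of_collapse`), so `T` is maximal.

The norm of the Cotton–York tensor carries a factor `1 / √(det g)` that the volume cancels, so the
`L¹`-norm is a positive constant times `|r (1 - r)|` (`cottonL1_eq`), that is, times `|u (1 - u)|`
with `u = σ A²`. Now `u` moves strictly monotonically to `0` with the sign of `1 - A₀ / B₀`. If `u`
starts above `1/2`, the norm rises until `u = 1/2` and then falls; if `u` starts in `(0, 1/2]` or
below `0`, it only falls; if `σ = 0`, it vanishes. -/

@[simp]
theorem lieDeriv_const (X : su2) (c : ℝ) (x : SU2) : lieDeriv X (fun _ => c) x = 0 := by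
  simp [lieDeriv]

section Algebraic

variable (c : Fin 3 → Fin 3 → Fin 3 → ℝ) (G : Matrix (Fin 3) (Fin 3) ℝ)

/-- The Koszul expression of a left-invariant metric with Gram matrix `G` in a frame with
structure constants `c`. -/
def invKoszul (i j k : Fin 3) : ℝ :=
  (1 / 2) * (∑ m, c i j m * G m k - ∑ m, c i k m * G m j - ∑ m, c j k m * G m i)

/-- The connection coefficients of a left-invariant metric. -/
def invChristoffel (i j k : Fin 3) : ℝ := ∑ l, G⁻¹ k l * invKoszul c G i j l

/-- The Ricci tensor of a left-invariant metric. -/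
def invRicci (j k : Fin 3) : ℝ :=
  ∑ i, ∑ m, (invChristoffel c G j k m * invChristoffel c G i m i
    - invChristoffel c G i k m * invChristoffel c G j m i
    - c i j m * invChristoffel c G m k i)

/-- The covariant derivative of the Ricci tensor of a left-invariant metric. -/
def invNablaRicci (l m j : Fin 3) : ℝ :=
  -∑ p, (invChristoffel c G l m p * invRicci c G p j + invChristoffel c G l j p * invRicci c G m p)

/-- The Cotton–York tensor of a left-invariant metric. -/
def invCottonYork (i j : Fin 3) : ℝ :=
  ∑ k, ∑ l, ∑ m, G i k * (eta k l m / √G.det) * invNablaRicci c G l m j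

/-- The pointwise norm of the Cotton–York tensor of a left-invariant metric. -/
def invCottonYorkNorm : ℝ :=
  √(∑ i, ∑ j, ∑ p, ∑ q, G⁻¹ i p * G⁻¹ j q * invCottonYork c G i j * invCottonYork c G p q)

end Algebraic

theorem RiemannianMetric.LeftInvariant.form_eq {g : RiemannianMetric} (hg : g.LeftInvariant)
    (x : SU2) : g.form x = g.form 1 := by
  ext X Y
  simpa using hg x 1 X Y

theorem form_bracket (F : Frame) (g : RiemannianMetric) (x : SU2) (i j k : Fin 3) :
    g.form x ⁅F i, F j⁆ (F k) = ∑ m, structConst F i j m * gram F g x m k := by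
  conv_lhs => rw [← F.sum_repr ⁅F i, F j⁆]
  simp only [map_sum, map_smul, LinearMap.sum_apply, LinearMap.smul_apply, smul_eq_mul, structConst,
    gram, Matrix.of_apply]

section LeftInvariant

variable (F : Frame) {g : RiemannianMetric}

theorem gram_eq (hg : g.LeftInvariant) (x : SU2) : gram F g x = gram F g 1 := by
  simp [gram, hg.form_eq x]

theorem koszul_eq (hg : g.LeftInvariant) (i j k : Fin 3) (x : SU2) :
    koszul F g i j k x = invKoszul (structConst F) (gram F g 1) i j k := by
  have h : ∀ X Y, (fun y => g.form y X Y) = fun _ => g.form 1 X Y := fun X Y => by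
    funext y; rw [hg.form_eq y]
  simp only [koszul, invKoszul, h, lieDeriv_const, form_bracket, gram_eq F hg x]
  ring

theorem christoffel_eq (hg : g.LeftInvariant) (i j k : Fin 3) :
    christoffel F g i j k = fun _ => invChristoffel (structConst F) (gram F g 1) i j k := by
  funext x
  simp only [christoffel, invChristoffel, gramInv, koszul_eq F hg, gram_eq F hg x]

theorem ricci_eq (hg : g.LeftInvariant) (j k : Fin 3) :
    ricci F g j k = fun _ => invRicci (structConst F) (gram F g 1) j k := by
  funext x
  simp only [ricci, riemann, invRicci, christoffel_eq F hg, lieDeriv_const]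
  simp

theorem scalarCurv_eq (hg : g.LeftInvariant) : scalarCurv F g = fun _ => scalarCurv F g 1 := by
  funext x
  simp only [scalarCurv, ricci_eq F hg, gramInv, gram_eq F hg x]

theorem nablaRicci_eq (hg : g.LeftInvariant) (l m j : Fin 3) (x : SU2) :
    nablaRicci F g l m j x = invNablaRicci (structConst F) (gram F g 1) l m j := by
  simp only [nablaRicci, invNablaRicci, ricci_eq F hg, christoffel_eq F hg, lieDeriv_const]
  simp

theorem cottonYork_eq (hg : g.LeftInvariant) (i j : Fin 3) (x : SU2) :
    cottonYork F g i j x = invCottonYork (structConst F) (gram F g 1) i j := by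
  simp only [cottonYork, invCottonYork, nablaRicci_eq F hg, gram_eq F hg x]
  -- The scalar curvature is constant, so the trace correction in the Cotton–York tensor drops out.
  rw [scalarCurv_eq F hg]
  simp

theorem cottonYorkNorm_eq (hg : g.LeftInvariant) (x : SU2) :
    cottonYorkNorm F g x = invCottonYorkNorm (structConst F) (gram F g 1) := by
  simp only [cottonYorkNorm, invCottonYorkNorm, cottonYork_eq F hg, gramInv, gram_eq F hg x]

end LeftInvariant

theorem bracket_swap (X Y : su2) : ⁅Y, X⁆ = -⁅X, Y⁆ := by
  apply Subtype.ext
  change Y.1 * X.1 - X.1 * Y.1 = -(X.1 * Y.1 - Y.1 * X.1)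
  abel

theorem bracket_same (X : su2) : ⁅X, X⁆ = 0 := by
  apply Subtype.ext
  change X.1 * X.1 - X.1 * X.1 = 0
  abel

theorem Frame.IsMilnor.structConst_eq {F : Frame} (hF : F.IsMilnor) :
    structConst F = fun i j k => -2 * eta i j k := by
  obtain ⟨h0, h1, h2⟩ := hF
  funext i j k
  have h0' := bracket_swap (F 1) (F 2)
  have h1' := bracket_swap (F 2) (F 0)
  have h2' := bracket_swap (F 0) (F 1)
  rw [h0] at h0'
  rw [h1] at h1'
  rw [h2] at h2'
  fin_cases i <;> fin_cases j <;>
    simp [structConst, bracket_same, h0, h1, h2, h0', h1', h2'] <;>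
    fin_cases k <;> simp [eta] <;> norm_num

/-! ### Berger metrics -/

section Berger

variable {a b : ℝ}

theorem inv_diagonal_berger (ha : a ≠ 0) (hb : b ≠ 0) :
    (Matrix.diagonal ![a, b, b])⁻¹ = Matrix.diagonal ![a⁻¹, b⁻¹, b⁻¹] := by
  apply Matrix.inv_eq_right_inv
  rw [Matrix.diagonal_mul_diagonal, ← Matrix.diagonal_one]
  congr 1
  funext i
  fin_cases i <;> simp [ha, hb]

/-- Only coefficients with three distinct indices survive, so `i` and `k` determine the entry; the
diagonal of the table is a placeholder that `eta` kills. -/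
theorem invChristoffel_berger (ha : a ≠ 0) (hb : b ≠ 0) (i j k : Fin 3) :
    invChristoffel (fun i j k => -2 * eta i j k) (Matrix.diagonal ![a, b, b]) i j k =
      eta i j k * ![![0, a / b - 2, a / b - 2], ![-1, 0, -(a / b)], ![-1, -(a / b), 0]] i k := by
  rw [invChristoffel, inv_diagonal_berger ha hb]
  fin_cases i <;> fin_cases j <;> fin_cases k <;>
    simp [invKoszul, eta, Matrix.diagonal] <;> field_simp <;> ring

theorem invRicci_berger (ha : a ≠ 0) (hb : b ≠ 0) (i j : Fin 3) :
    invRicci (fun i j k => -2 * eta i j k) (Matrix.diagonal ![a, b, b]) i j =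
      Matrix.diagonal ![2 * (a / b) ^ 2, 4 - 2 * (a / b), 4 - 2 * (a / b)] i j := by
  simp only [invRicci, invChristoffel_berger ha hb]
  fin_cases i <;> fin_cases j <;>
    simp [eta, Fin.sum_univ_three, Matrix.diagonal] <;> ring

theorem det_diagonal_berger : (Matrix.diagonal ![a, b, b]).det = a * b ^ 2 := by
  simp [Matrix.det_diagonal, Fin.prod_univ_three]; ring

/-- The block `l = 0` vanishes because `∇` along `F 0` rotates the plane of `F 1` and `F 2`, on
which the Ricci tensor is a multiple of the metric. The factor `1 - a / b` reflects that the round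
metric is Einstein. -/
theorem invNablaRicci_berger (ha : a ≠ 0) (hb : b ≠ 0) (l m j : Fin 3) :
    invNablaRicci (fun i j k => -2 * eta i j k) (Matrix.diagonal ![a, b, b]) l m j =
      4 * (a / b) * (1 - a / b) *
        ![0, !![0, 0, -1; 0, 0, 0; -1, 0, 0], !![0, 1, 0; 1, 0, 0; 0, 0, 0]] l m j := by
  simp only [invNablaRicci, invRicci_berger ha hb, invChristoffel_berger ha hb]
  fin_cases l <;> fin_cases m <;> fin_cases j <;>
    simp [eta, Fin.sum_univ_three, Matrix.diagonal] <;> ring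

theorem invCottonYork_berger (ha : a ≠ 0) (hb : b ≠ 0) (i j : Fin 3) :
    invCottonYork (fun i j k => -2 * eta i j k) (Matrix.diagonal ![a, b, b]) i j =
      4 * (a / b) * (1 - a / b) / √(a * b ^ 2) * Matrix.diagonal ![-2 * a, b, b] i j := by
  simp only [invCottonYork, invNablaRicci_berger ha hb, det_diagonal_berger]
  generalize √(a * b ^ 2) = d
  generalize a / b = r
  fin_cases i <;> fin_cases j <;>
    simp [eta, Fin.sum_univ_three, Matrix.diagonal] <;> ring

/-- Relative to the metric the eigenvalues of the Cotton–York tensor are proportional to `-2, 1, 1`,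
whose squares sum to `6`. -/
theorem invCottonYorkNorm_berger (ha : a ≠ 0) (hb : b ≠ 0) :
    invCottonYorkNorm (fun i j k => -2 * eta i j k) (Matrix.diagonal ![a, b, b]) =
      4 * √6 * |a / b * (1 - a / b)| / √(a * b ^ 2) := by
  have h : 0 ≤ 4 * √6 * |a / b * (1 - a / b)| / √(a * b ^ 2) := by positivity
  rw [invCottonYorkNorm, ← Real.sqrt_sq h, inv_diagonal_berger ha hb]
  congr 1
  rw [div_pow, mul_pow, sq_abs, mul_pow, Real.sq_sqrt (by norm_num)]
  simp only [invCottonYork_berger ha hb]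
  generalize √(a * b ^ 2) = d
  simp [Fin.sum_univ_three, Matrix.diagonal]
  field_simp
  ring

end Berger

/-! ### Uniqueness for autonomous ordinary differential equations -/

theorem hasDerivWithinAt_Ici_of_Ico {E : Type*} [NormedAddCommGroup E] [NormedSpace ℝ E]
    {f : ℝ → E} {f' : E} {a b t : ℝ} (ht : t ∈ Set.Ico a b)
    (h : HasDerivWithinAt f f' (Set.Ico a b) t) : HasDerivWithinAt f f' (Set.Ici t) t :=
  (h.mono (Set.Ico_subset_Ico_left ht.1)).mono_of_mem_nhdsWithin (Ico_mem_nhdsGE ht.2)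

/-- Both orbits over `[0, t]` form a compact subset of `U`. There the locally Lipschitz field `v` is
Lipschitz with one constant, and the standard uniqueness theorem applies. -/
theorem eqOn_of_hasDerivWithinAt_of_contDiffAt {E : Type*} [NormedAddCommGroup E]
    [NormedSpace ℝ E] {v : E → E} {U : Set E} (hv : ∀ y ∈ U, ContDiffAt ℝ 1 v y)
    {f g : ℝ → E} {T : ℝ}
    (hf : ∀ t ∈ Set.Ico 0 T, HasDerivWithinAt f (v (f t)) (Set.Ico 0 T) t)
    (hfU : ∀ t ∈ Set.Ico 0 T, f t ∈ U)
    (hg : ∀ t ∈ Set.Ico 0 T, HasDerivWithinAt g (v (g t)) (Set.Ico 0 T) t)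
    (hgU : ∀ t ∈ Set.Ico 0 T, g t ∈ U) (h0 : f 0 = g 0) :
    Set.EqOn f g (Set.Ico 0 T) := by
  intro t ht
  have hsub : Set.Icc 0 t ⊆ Set.Ico 0 T := fun s hs => ⟨hs.1, hs.2.trans_lt ht.2⟩
  have hsub' : Set.Ico 0 t ⊆ Set.Ico 0 T := Set.Ico_subset_Icc_self.trans hsub
  have hfc : ContinuousOn f (Set.Icc 0 t) := fun s hs =>
    (hf s (hsub hs)).continuousWithinAt.mono hsub
  have hgc : ContinuousOn g (Set.Icc 0 t) := fun s hs =>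
    (hg s (hsub hs)).continuousWithinAt.mono hsub
  have hK : IsCompact (f '' Set.Icc 0 t ∪ g '' Set.Icc 0 t) :=
    (isCompact_Icc.image_of_continuousOn hfc).union (isCompact_Icc.image_of_continuousOn hgc)
  have hL : LocallyLipschitzOn (f '' Set.Icc 0 t ∪ g '' Set.Icc 0 t) v := by
    intro y hy
    have hyU : y ∈ U := by
      rcases hy with ⟨s, hs, rfl⟩ | ⟨s, hs, rfl⟩
      · exact hfU s (hsub hs)
      · exact hgU s (hsub hs)
    obtain ⟨K, N, hN, hKN⟩ := (hv y hyU).exists_lipschitzOnWith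
    exact ⟨K, N, mem_nhdsWithin_of_mem_nhds hN, hKN⟩
  obtain ⟨K, hKv⟩ := hL.exists_lipschitzOnWith_of_compact hK
  exact ODE_solution_unique_of_mem_Icc_right (v := fun _ => v) (fun _ _ => hKv) hfc
    (fun s hs => hasDerivWithinAt_Ici_of_Ico (hsub' hs) (hf s (hsub' hs)))
    (fun s hs => Or.inl ⟨s, Set.Ico_subset_Icc_self hs, rfl⟩) hgc
    (fun s hs => hasDerivWithinAt_Ici_of_Ico (hsub' hs) (hg s (hsub' hs)))
    (fun s hs => Or.inr ⟨s, Set.Ico_subset_Icc_self hs, rfl⟩) h0 ⟨ht.1, le_rfl⟩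

/-! ### The Ricci flow of left-invariant metrics as an ordinary differential equation -/

/-- The right-hand side `-2 Ric` of the Ricci flow on Gram matrices of left-invariant metrics. -/
def ricciField (c : Fin 3 → Fin 3 → Fin 3 → ℝ) (G : Fin 3 → Fin 3 → ℝ) : Fin 3 → Fin 3 → ℝ :=
  fun i j => -2 * invRicci c (Matrix.of G) i j

theorem contDiff_det : ContDiff ℝ 1 fun G : Fin 3 → Fin 3 → ℝ => (Matrix.of G).det := by
  simp only [Matrix.det_fin_three, Matrix.of_apply]
  fun_prop

theorem contDiffAt_inv_apply {G : Fin 3 → Fin 3 → ℝ} (hG : (Matrix.of G).det ≠ 0) (i j : Fin 3) :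
    ContDiffAt ℝ 1 (fun H : Fin 3 → Fin 3 → ℝ => (Matrix.of H)⁻¹ i j) G := by
  simp only [Matrix.inv_def, Ring.inverse_eq_inv', Matrix.smul_apply, smul_eq_mul]
  refine (contDiff_det.contDiffAt.inv hG).mul ?_
  fin_cases i <;> fin_cases j <;> simp [Matrix.adjugate_fin_three] <;> fun_prop

/-- The Ricci tensor is a polynomial in the entries of `G` and `G⁻¹`, hence rational with a power of
`det G` as denominator. -/
theorem contDiffAt_ricciField (c : Fin 3 → Fin 3 → Fin 3 → ℝ) {G : Fin 3 → Fin 3 → ℝ}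
    (hG : (Matrix.of G).det ≠ 0) : ContDiffAt ℝ 1 (ricciField c) G := by
  have hK : ∀ i j k, ContDiffAt ℝ 1 (fun H => invKoszul c (Matrix.of H) i j k) G := by
    intro i j k
    simp only [invKoszul, Matrix.of_apply]
    fun_prop
  have hΓ : ∀ i j k, ContDiffAt ℝ 1 (fun H => invChristoffel c (Matrix.of H) i j k) G := by
    intro i j k
    exact ContDiffAt.sum fun l _ => (contDiffAt_inv_apply hG k l).mul (hK i j l)
  refine contDiffAt_pi.2 fun i => contDiffAt_pi.2 fun j => contDiffAt_const.mul ?_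
  exact ContDiffAt.sum fun k _ => ContDiffAt.sum fun m _ =>
    (((hΓ _ _ _).mul (hΓ _ _ _)).sub ((hΓ _ _ _).mul (hΓ _ _ _))).sub
      (contDiffAt_const.mul (hΓ _ _ _))

/-- Stated for an arbitrary positive form so as to serve both the metric `g` and the round metric in
the volume density. -/
theorem posDef_of_basis {V : Type*} [AddCommGroup V] [Module ℝ V] (F : Module.Basis (Fin 3) ℝ V)
    (b : LinearMap.BilinForm ℝ V) (hs : ∀ X Y, b X Y = b Y X) (hp : ∀ X, X ≠ 0 → 0 < b X X) :
    (Matrix.of fun i j => b (F i) (F j)).PosDef := by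
  refine Matrix.PosDef.of_dotProduct_mulVec_pos ?_ fun x hx => ?_
  · ext i j
    simp [hs (F j) (F i)]
  · have h : ∑ i, x i • F i ≠ 0 := by
      intro h
      exact hx (funext fun i => Fintype.linearIndependent_iff.1 F.linearIndependent x h i)
    refine (hp _ h).trans_eq ?_
    simp only [map_sum, map_smul, LinearMap.sum_apply, LinearMap.smul_apply, smul_eq_mul,
      dotProduct, Matrix.mulVec, Matrix.of_apply, Finset.mul_sum, Pi.star_apply, star_trivial]
    exact Finset.sum_congr rfl fun i _ => Finset.sum_congr rfl fun j _ => by rw [hs (F j)]; ring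

theorem det_gram_pos (F : Frame) (g : RiemannianMetric) (x : SU2) : 0 < (gram F g x).det :=
  (posDef_of_basis F (g.form x) (g.symm x) (g.pos x)).det_pos

theorem RiemannianMetric.ext_gram {F : Frame} {g g' : RiemannianMetric}
    (h : ∀ x, gram F g x = gram F g' x) : g = g' := by
  ext x : 2
  refine F.ext fun i => F.ext fun j => ?_
  exact congrFun (congrFun (h x) i) j

theorem IsRicciFlow.hasDerivWithinAt_gram {F : Frame} {T : ℝ} {g : ℝ → RiemannianMetric}
    (hg : IsRicciFlow F T g) (hinv : ∀ t ∈ Set.Ico 0 T, (g t).LeftInvariant) {t : ℝ}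
    (ht : t ∈ Set.Ico 0 T) :
    HasDerivWithinAt (fun s => (gram F (g s) 1 : Fin 3 → Fin 3 → ℝ))
      (ricciField (structConst F) (gram F (g t) 1)) (Set.Ico 0 T) t := by
  refine hasDerivWithinAt_pi.2 fun i => hasDerivWithinAt_pi.2 fun j => ?_
  have h := hg.evolution t ht 1 i j
  rw [ricci_eq F (hinv t ht)] at h
  exact h

theorem IsRicciFlow.mono {F : Frame} {T T' : ℝ} {g : ℝ → RiemannianMetric}
    (hg : IsRicciFlow F T g) (h : T' ≤ T) : IsRicciFlow F T' g where
  smooth X Y := by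
    obtain ⟨f, hf, hf'⟩ := hg.smooth X Y
    have hs := Set.Ico_subset_Ico_right (b := (0 : ℝ)) h
    exact ⟨f, hf.mono (Set.prod_mono hs subset_rfl), fun t ht => hf' t (hs ht)⟩
  evolution t ht x i j :=
    (hg.evolution t (Set.Ico_subset_Ico_right h ht) x i j).mono (Set.Ico_subset_Ico_right h)

/-- Uniqueness of the Ricci flow among left-invariant metrics. -/
theorem IsRicciFlow.eq_of_leftInvariant {F : Frame} {T : ℝ} {g g' : ℝ → RiemannianMetric}
    (hg : IsRicciFlow F T g) (hinv : ∀ t ∈ Set.Ico 0 T, (g t).LeftInvariant)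
    (hg' : IsRicciFlow F T g') (hinv' : ∀ t ∈ Set.Ico 0 T, (g' t).LeftInvariant)
    (h0 : g 0 = g' 0) {t : ℝ} (ht : t ∈ Set.Ico 0 T) : g t = g' t := by
  have h := eqOn_of_hasDerivWithinAt_of_contDiffAt
    (U := {G : Fin 3 → Fin 3 → ℝ | (Matrix.of G).det ≠ 0})
    (fun G hG => contDiffAt_ricciField (structConst F) hG)
    (fun t ht => hg.hasDerivWithinAt_gram hinv ht) (fun t _ => (det_gram_pos F (g t) 1).ne')
    (fun t ht => hg'.hasDerivWithinAt_gram hinv' ht) (fun t _ => (det_gram_pos F (g' t) 1).ne')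
    (by rw [h0]) ht
  refine RiemannianMetric.ext_gram (F := F) fun x => ?_
  rw [gram_eq F (hinv t ht), gram_eq F (hinv' t ht)]
  exact h

/-! ### Diagonal metrics -/

section Diagonal

variable {F : Frame} {g : RiemannianMetric} {a b c : ℝ}

theorem RiemannianMetric.IsDiagonal.gram_eq (hg : g.IsDiagonal F a b c) (x : SU2) :
    gram F g x = Matrix.diagonal ![a, b, c] := by
  ext i j
  exact hg x i j

theorem RiemannianMetric.IsDiagonal.eq {g' : RiemannianMetric} (hg : g.IsDiagonal F a b c)
    (hg' : g'.IsDiagonal F a b c) : g = g' :=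
  RiemannianMetric.ext_gram (F := F) fun x => by rw [hg.gram_eq, hg'.gram_eq]

theorem RiemannianMetric.IsDiagonal.leftInvariant (hg : g.IsDiagonal F a b c) :
    g.LeftInvariant := by
  intro y x X Y
  have h : g.form (y * x) = g.form x :=
    F.ext fun i => F.ext fun j => (hg (y * x) i j).trans (hg x i j).symm
  rw [h]

theorem RiemannianMetric.IsDiagonal.form_apply (hg : g.IsDiagonal F a b c) (x : SU2) (X Y : su2) :
    g.form x X Y = a * (F.repr X 0 * F.repr Y 0) + b * (F.repr X 1 * F.repr Y 1)
      + c * (F.repr X 2 * F.repr Y 2) := by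
  have h : ∀ i j, g.form x (F i) (F j) = Matrix.diagonal ![a, b, c] i j := hg x
  conv_lhs => rw [← F.sum_repr X, ← F.sum_repr Y]
  simp only [Fin.sum_univ_three, map_add, map_smul, LinearMap.add_apply, LinearMap.smul_apply,
    smul_eq_mul, h]
  simp [Matrix.diagonal]
  ring

theorem RiemannianMetric.IsDiagonal.fst_pos (hg : g.IsDiagonal F a b c) : 0 < a := by
  have h := g.pos 1 (F 0) (F.ne_zero 0)
  rw [hg] at h
  simpa using h

theorem RiemannianMetric.IsDiagonal.snd_pos (hg : g.IsDiagonal F a b c) : 0 < b := by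
  have h := g.pos 1 (F 1) (F.ne_zero 1)
  rw [hg] at h
  simpa using h

theorem RiemannianMetric.IsDiagonal.ricci_eq (hF : F.IsMilnor) (hg : g.IsDiagonal F a b b)
    (i j : Fin 3) (x : SU2) : ricci F g i j x =
      Matrix.diagonal ![2 * (a / b) ^ 2, 4 - 2 * (a / b), 4 - 2 * (a / b)] i j := by
  rw [CottonFlow.ricci_eq F hg.leftInvariant, hg.gram_eq, hF.structConst_eq,
    invRicci_berger hg.fst_pos.ne' hg.snd_pos.ne']

end Diagonal

/-- The Berger metric `a ω¹ ⊗ ω¹ + b (ω² ⊗ ω² + ω³ ⊗ ω³)`. -/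
def bergerMetric (F : Frame) (a b : ℝ) (ha : 0 < a) (hb : 0 < b) : RiemannianMetric where
  form _ := LinearMap.mk₂ ℝ (fun X Y => a * (F.repr X 0 * F.repr Y 0)
      + b * (F.repr X 1 * F.repr Y 1) + b * (F.repr X 2 * F.repr Y 2))
    (fun X X' Y => by simp; ring) (fun s X Y => by simp; ring)
    (fun X Y Y' => by simp; ring) (fun s X Y => by simp; ring)
  symm x X Y := by simp only [LinearMap.mk₂_apply]; ring
  pos x X hX := by
    simp only [LinearMap.mk₂_apply]
    by_contra h
    have h0 := mul_self_nonneg (F.repr X 0)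
    have h1 := mul_self_nonneg (F.repr X 1)
    have h2 := mul_self_nonneg (F.repr X 2)
    have h0' := mul_nonneg ha.le h0
    have h1' := mul_nonneg hb.le h1
    have h2' := mul_nonneg hb.le h2
    refine hX (F.ext_elem fun i => ?_)
    fin_cases i
    · have : a * (F.repr X 0 * F.repr X 0) = 0 := by linarith
      simpa [ha.ne'] using this
    · have : b * (F.repr X 1 * F.repr X 1) = 0 := by linarith
      simpa [hb.ne'] using this
    · have : b * (F.repr X 2 * F.repr X 2) = 0 := by linarith
      simpa [hb.ne'] using this
  smooth X Y := ⟨fun _ => _, contDiff_const, fun _ => rfl⟩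

theorem bergerMetric_isDiagonal (F : Frame) {a b : ℝ} (ha : 0 < a) (hb : 0 < b) :
    (bergerMetric F a b ha hb).IsDiagonal F a b b := by
  intro x i j
  fin_cases i <;> fin_cases j <;> simp [bergerMetric, Matrix.diagonal]

/-! ### The `L¹`-norm of the Cotton–York tensor of a Berger metric -/

/-- The round metric as a bilinear form. -/
def roundForm : LinearMap.BilinForm ℝ su2 :=
  LinearMap.mk₂ ℝ roundInner
    (fun X X' Y => by simp [roundInner, add_mul]; ring)
    (fun s X Y => by simp [roundInner]; ring)
    (fun X Y Y' => by simp [roundInner, mul_add])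
    (fun s X Y => by simp [roundInner]; ring)

theorem roundInner_comm (X Y : su2) : roundInner X Y = roundInner Y X := by
  simp [roundInner, Matrix.trace_fin_two, Matrix.mul_apply, Fin.sum_univ_two]
  ring

theorem roundInner_self_pos (X : su2) (hX : X ≠ 0) : 0 < roundInner X X := by
  have h : roundInner X X = (1 / 2) * ∑ i, ∑ j, Complex.normSq (X.1 i j) := by
    simp [roundInner, Matrix.trace_fin_two, Matrix.mul_apply, Fin.sum_univ_two,
      Complex.normSq_apply]
  rw [h]
  by_contra hc
  refine hX (Subtype.ext (Matrix.ext fun i j => ?_))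
  have hnn : ∀ i, 0 ≤ ∑ j, Complex.normSq (X.1 i j) := fun i =>
    Finset.sum_nonneg fun j _ => Complex.normSq_nonneg _
  have h0 : ∑ i, ∑ j, Complex.normSq (X.1 i j) = 0 :=
    le_antisymm (by linarith) (Finset.sum_nonneg fun i _ => hnn i)
  have h1 := (Finset.sum_eq_zero_iff_of_nonneg fun i _ => hnn i).1 h0 i (Finset.mem_univ i)
  have h2 := (Finset.sum_eq_zero_iff_of_nonneg fun j _ => Complex.normSq_nonneg _).1 h1 j
    (Finset.mem_univ j)
  simpa using h2

theorem det_round_pos (F : Frame) : 0 < (Matrix.of fun i j => roundInner (F i) (F j)).det :=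
  (posDef_of_basis F roundForm roundInner_comm roundInner_self_pos).det_pos

/-- The constant that relates `cottonL1` to the ratio `a / b` of a Berger metric. -/
def cottonConst (F : Frame) : ℝ :=
  (MeasureTheory.volume : MeasureTheory.Measure (EuclideanSpace ℝ (Fin 4))).toSphere.real Set.univ *
    (4 * √6 / √(Matrix.of fun i j => roundInner (F i) (F j)).det)

theorem cottonConst_pos (F : Frame) : 0 < cottonConst F := by
  have h := Real.sqrt_pos.2 (det_round_pos F)
  have h' : 0 < (MeasureTheory.volume :
      MeasureTheory.Measure (EuclideanSpace ℝ (Fin 4))).toSphere.real Set.univ := by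
    rw [MeasureTheory.measureReal_def]
    refine ENNReal.toReal_pos ?_ (MeasureTheory.measure_ne_top _ _)
    rw [Ne, MeasureTheory.Measure.measure_univ_eq_zero]
    exact MeasureTheory.Measure.toSphere_ne_zero _
  unfold cottonConst
  positivity

/-- The integrand is constant, and `√(a * b ^ 2)` occurs in the denominator of the norm and in the
numerator of the volume density. -/
theorem RiemannianMetric.IsDiagonal.cottonL1_eq {F : Frame} {g : RiemannianMetric} {a b : ℝ}
    (hF : F.IsMilnor) (hg : g.IsDiagonal F a b b) :
    cottonL1 F g = cottonConst F * |a / b * (1 - a / b)| := by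
  have ha := hg.fst_pos
  have hb := hg.snd_pos
  have hd : √(a * b ^ 2) ≠ 0 := (Real.sqrt_pos.2 (by positivity)).ne'
  have hr : √(Matrix.of fun i j => roundInner (F i) (F j)).det ≠ 0 :=
    (Real.sqrt_pos.2 (det_round_pos F)).ne'
  simp only [cottonL1, cottonYorkNorm_eq F hg.leftInvariant, volDensity, hg.gram_eq,
    hF.structConst_eq, invCottonYorkNorm_berger ha.ne' hb.ne', det_diagonal_berger,
    MeasureTheory.integral_const, smul_eq_mul, cottonConst]
  rw [Real.sqrt_div (by positivity)]
  field_simp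

/-! ### The evolution of the coefficients of a Berger metric -/

/-- A scalar autonomous equation `y' = -φ(y)` with `φ` positive, continuous and bounded has a
global strictly decreasing solution that takes every value. -/
theorem exists_strictAnti_solution {φ : ℝ → ℝ} (hφ : Continuous φ) (hpos : ∀ s, 0 < φ s) {M : ℝ}
    (hM : ∀ s, φ s ≤ M) (a₀ : ℝ) :
    ∃ A : ℝ → ℝ, A 0 = a₀ ∧ StrictAnti A ∧ Function.Surjective A ∧
      ∀ t, HasDerivAt A (-φ (A t)) t := by
  have hMpos : 0 < M := (hpos 0).trans_le (hM 0)
  have hinv : Continuous fun s => (φ s)⁻¹ := hφ.inv₀ fun s => (hpos s).ne'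
  -- Separation of variables: `-τ a` is the time at which the value `a` is taken, so the solution is
  -- the inverse of `τ` evaluated at `-t`.
  set τ : ℝ → ℝ := fun a => ∫ s in a₀..a, (φ s)⁻¹ with hτ
  have hder : ∀ a, HasDerivAt τ (φ a)⁻¹ a := fun a =>
    intervalIntegral.integral_hasDerivAt_right (hinv.intervalIntegrable _ _)
      (hinv.stronglyMeasurableAtFilter _ _) hinv.continuousAt
  have hτ0 : τ a₀ = 0 := intervalIntegral.integral_same
  have hmono : StrictMono τ := strictMono_of_deriv_pos fun a => by
    rw [(hder a).deriv]; exact inv_pos.2 (hpos a)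
  have hcont : Continuous τ := continuous_iff_continuousAt.2 fun a => (hder a).continuousAt
  -- The bound `φ ≤ M` makes `τ` grow at least linearly, which gives surjectivity.
  have hlin : Monotone fun a => τ a - a * M⁻¹ := by
    have hd : ∀ a, HasDerivAt (fun a => τ a - a * M⁻¹) ((φ a)⁻¹ - 1 * M⁻¹) a := fun a =>
      (hder a).sub ((hasDerivAt_id a).mul_const _)
    refine monotone_of_deriv_nonneg (fun a => (hd a).differentiableAt) fun a => ?_
    rw [(hd a).deriv, one_mul, sub_nonneg]
    exact inv_anti₀ (hpos a) (hM a)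
  have hMi : 0 < M⁻¹ := inv_pos.2 hMpos
  have hsurj : Function.Surjective τ := by
    refine hcont.surjective ?_ ?_
    · refine Filter.tendsto_atTop_mono' _ (f₁ := fun a => a * M⁻¹ + -(a₀ * M⁻¹)) ?_
        (Filter.tendsto_atTop_add_const_right _ _ (Filter.tendsto_id.atTop_mul_const hMi))
      filter_upwards [Filter.eventually_ge_atTop a₀] with a ha
      have := hlin ha
      simp only [hτ0] at this
      linarith
    · refine Filter.tendsto_atBot_mono' _ (f₁ := fun a => a * M⁻¹ + -(a₀ * M⁻¹)) ?_
        (Filter.tendsto_atBot_add_const_right _ _ (Filter.tendsto_id.atBot_mul_const hMi))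
      filter_upwards [Filter.eventually_le_atBot a₀] with a ha
      have := hlin ha
      simp only [hτ0] at this
      linarith
  set e : ℝ ≃o ℝ := hmono.orderIsoOfSurjective τ hsurj with he
  have heτ : ∀ a, e a = τ a := fun a => rfl
  have hsymm : ∀ t, HasDerivAt e.symm (φ (e.symm t)) t := by
    intro t
    have h := HasDerivAt.of_local_left_inverse (f := τ) (g := e.symm) (a := t)
      e.symm.continuous.continuousAt (hder (e.symm t)) (inv_ne_zero (hpos _).ne')
      (Filter.Eventually.of_forall fun s => by rw [← heτ]; exact e.apply_symm_apply s)
    rwa [inv_inv] at h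
  refine ⟨fun t => e.symm (-t), ?_, ?_, ?_, ?_⟩
  · have h : e a₀ = 0 := hτ0
    simp only [neg_zero]
    rw [← h, OrderIso.symm_apply_apply]
  · intro s t hst
    exact e.symm.strictMono (neg_lt_neg hst)
  · intro a
    exact ⟨-e a, by simp⟩
  · intro t
    have h := (hsymm (-t)).comp t (hasDerivAt_neg t)
    rwa [mul_neg_one] at h

/-- A solution of a smooth autonomous equation is smooth. -/
theorem contDiffOn_infty_of_hasDerivAt {A φ : ℝ → ℝ} {O : Set ℝ} (hO : IsOpen O)
    (hφ : ContDiff ℝ ∞ φ) (hA : ∀ t ∈ O, HasDerivAt A (φ (A t)) t) : ContDiffOn ℝ ∞ A O := by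
  rw [contDiffOn_infty]
  intro n
  induction n with
  | zero =>
    exact contDiffOn_zero.2 fun t ht => (hA t ht).continuousAt.continuousWithinAt
  | succ n ih =>
    push_cast
    rw [contDiffOn_succ_iff_deriv_of_isOpen hO]
    refine ⟨fun t ht => (hA t ht).differentiableAt.differentiableWithinAt, by simp, ?_⟩
    -- Bootstrapping: the derivative `φ ∘ A` is as smooth as `A` is already known to be.
    exact ((hφ.of_le (by exact_mod_cast le_top)).comp_contDiffOn ih).congr
      fun t ht => (hA t ht).deriv

/-- The field `4 (1 - σ s²)²` may vanish or be unbounded for large `s`, so `s²` is cut off at `b²`.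
The solution stays in `(0, a₀]` on `[0, T)` and never meets the cutoff. -/
theorem exists_berger_profile {a₀ σ : ℝ} (ha : 0 < a₀) (hσ : 0 < 1 - σ * a₀ ^ 2) :
    ∃ T > 0, ∃ A : ℝ → ℝ, A 0 = a₀ ∧ A T = 0 ∧ Continuous A ∧ StrictAnti A ∧
      ContDiffOn ℝ ∞ A (Set.Ico 0 T) ∧
      ∀ t ∈ Set.Ico 0 T, HasDerivAt A (-4 * (1 - σ * A t ^ 2) ^ 2) t := by
  -- The strict inequality `a₀ < b` puts `t = 0` in the interior of the region where the cutoff is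
  -- inactive, so the two-sided derivative and smoothness hold there too.
  obtain ⟨b, hb, hab⟩ : ∃ b, 0 < 1 - σ * b ^ 2 ∧ a₀ < b := by
    have h : ∀ᶠ b in 𝓝[>] a₀, 0 < 1 - σ * b ^ 2 := by
      have hc : ContinuousAt (fun b : ℝ => 1 - σ * b ^ 2) a₀ := by fun_prop
      exact nhdsWithin_le_nhds (hc.eventually (lt_mem_nhds hσ))
    exact (h.and self_mem_nhdsWithin).exists
  have hcut : ∀ s, 0 < 1 - σ * min (s ^ 2) (b ^ 2) ∧
      1 - σ * min (s ^ 2) (b ^ 2) ≤ 1 + |σ| * b ^ 2 := by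
    intro s
    have h0 : 0 ≤ min (s ^ 2) (b ^ 2) := le_min (sq_nonneg _) (sq_nonneg _)
    have h1 : min (s ^ 2) (b ^ 2) ≤ b ^ 2 := min_le_right _ _
    constructor
    · rcases le_total σ 0 with h | h
      · nlinarith
      · nlinarith
    · have := mul_le_mul (neg_le_abs σ) h1 h0 (abs_nonneg σ)
      linarith
  obtain ⟨A, hA0, hanti, hsurj, hder⟩ := exists_strictAnti_solution
    (φ := fun s => 4 * (1 - σ * min (s ^ 2) (b ^ 2)) ^ 2) (by fun_prop)
    (fun s => by have := (hcut s).1; positivity) (M := 4 * (1 + |σ| * b ^ 2) ^ 2)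
    (fun s => by
      have := pow_le_pow_left₀ (hcut s).1.le (hcut s).2 2
      linarith) a₀
  have hcont : Continuous A := continuous_iff_continuousAt.2 fun t => (hder t).continuousAt
  obtain ⟨T, hT⟩ := hsurj 0
  have hTpos : 0 < T := hanti.lt_iff_gt.1 (by rw [hT, hA0]; exact ha)
  have hO : IsOpen {t | A t ∈ Set.Ioo 0 b} := isOpen_Ioo.preimage hcont
  have hsub : Set.Ico 0 T ⊆ {t | A t ∈ Set.Ioo 0 b} := fun t ht =>
    ⟨hT ▸ hanti ht.2, (hanti.antitone ht.1).trans_lt (hA0 ▸ hab)⟩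
  have hder' : ∀ t ∈ {t | A t ∈ Set.Ioo 0 b}, HasDerivAt A (-4 * (1 - σ * A t ^ 2) ^ 2) t := by
    intro t ht
    have h := hder t
    rwa [min_eq_left (pow_le_pow_left₀ ht.1.le ht.2.le 2), ← neg_mul] at h
  refine ⟨T, hTpos, A, hA0, hT, hcont, hanti, ?_, fun t ht => hder' t (hsub ht)⟩
  exact (contDiffOn_infty_of_hasDerivAt (φ := fun s => -4 * (1 - σ * s ^ 2) ^ 2) hO (by fun_prop)
    hder').mono hsub

/-! ### Strictly monotone functions have no interior local extrema -/

theorem not_isLocalExtr_of_strictMonoOn {f : ℝ → ℝ} {a b t : ℝ}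
    (hf : StrictMonoOn f (Set.Ioo a b)) (ht : t ∈ Set.Ioo a b) : ¬ IsLocalExtr f t := by
  have hn : Set.Ioo a b ∈ 𝓝 t := Ioo_mem_nhds ht.1 ht.2
  rintro (h | h)
  · have h' : ∀ᶠ s in 𝓝[<] t, f t ≤ f s ∧ s ∈ Set.Ioo a b :=
      nhdsWithin_le_nhds (h.and hn)
    obtain ⟨s, ⟨h1, h2⟩, h3⟩ := (h'.and self_mem_nhdsWithin).exists
    exact absurd (hf h2 ht h3) (not_lt.2 h1)
  · have h' : ∀ᶠ s in 𝓝[>] t, f s ≤ f t ∧ s ∈ Set.Ioo a b :=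
      nhdsWithin_le_nhds (h.and hn)
    obtain ⟨s, ⟨h1, h2⟩, h3⟩ := (h'.and self_mem_nhdsWithin).exists
    exact absurd (hf ht h2 h3) (not_lt.2 h1)

theorem not_isLocalExtr_of_strictAntiOn {f : ℝ → ℝ} {a b t : ℝ}
    (hf : StrictAntiOn f (Set.Ioo a b)) (ht : t ∈ Set.Ioo a b) : ¬ IsLocalExtr f t := fun h =>
  not_isLocalExtr_of_strictMonoOn (f := fun s => -f s)
    (fun _ hx _ hy hxy => neg_lt_neg (hf hx hy hxy)) ht h.neg

/-! ### Monotonicity along the flow -/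

section Profile

variable {T κ : ℝ} {u : ℝ → ℝ}

theorem strictAntiOn_profile_of_le_half (hκ : 0 < κ) {S : Set ℝ} (hu : StrictAntiOn u S)
    (hpos : ∀ t ∈ S, 0 < u t) (hle : ∀ t ∈ S, u t ≤ 1 / 2) :
    StrictAntiOn (fun t => κ * |(1 - u t) * u t|) S := by
  intro s hs t ht hst
  have h := hu hs ht hst
  have h1 := hpos t ht
  have h2 := hle s hs
  have h3 := hle t ht
  simp only
  rw [abs_of_pos (mul_pos (by linarith) h1), abs_of_pos (mul_pos (by linarith) (hpos s hs))]
  refine mul_lt_mul_of_pos_left ?_ hκ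
  nlinarith

theorem strictMonoOn_profile_of_half_le (hκ : 0 < κ) {S : Set ℝ} (hu : StrictAntiOn u S)
    (hlt : ∀ t ∈ S, u t < 1) (hge : ∀ t ∈ S, 1 / 2 ≤ u t) :
    StrictMonoOn (fun t => κ * |(1 - u t) * u t|) S := by
  -- The profile is invariant under `u ↦ 1 - u`, which exchanges the two halves of `(0, 1)`;
  -- reversing time keeps the function decreasing.
  have h := strictAntiOn_profile_of_le_half (κ := κ) (u := fun t => 1 - u (-t)) hκ (S := -S)
    (fun s hs t ht hst => by
      have := hu ht hs (neg_lt_neg hst); simp only; linarith)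
    (fun t ht => by have := hlt (-t) ht; linarith) (fun t ht => by have := hge (-t) ht; linarith)
  intro s hs t ht hst
  have := h (a := -t) (by simpa using ht) (b := -s) (by simpa using hs) (neg_lt_neg hst)
  simpa [mul_comm] using this

theorem strictAntiOn_profile_of_neg (hκ : 0 < κ) {S : Set ℝ} (hu : StrictMonoOn u S)
    (hneg : ∀ t ∈ S, u t < 0) : StrictAntiOn (fun t => κ * |(1 - u t) * u t|) S := by
  intro s hs t ht hst
  have h := hu hs ht hst
  have h1 := hneg t ht
  have h2 := hneg s hs
  simp only
  rw [abs_of_neg (mul_neg_of_pos_of_neg (by linarith) h1),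
    abs_of_neg (mul_neg_of_pos_of_neg (by linarith) h2)]
  refine mul_lt_mul_of_pos_left ?_ hκ
  nlinarith

theorem isLocalExtr_profile_iff (hκ : 0 < κ) (hanti : StrictAntiOn u (Set.Ico 0 T))
    (hpos : ∀ t ∈ Set.Ico 0 T, 0 < u t) (hlt : ∀ t ∈ Set.Ico 0 T, u t < 1) {t₀ : ℝ}
    (ht₀ : t₀ ∈ Set.Ioo 0 T) (hu₀ : u t₀ = 1 / 2) {f : ℝ → ℝ}
    (hf : ∀ t ∈ Set.Ico 0 T, f t = κ * |(1 - u t) * u t|) {t : ℝ} (ht : t ∈ Set.Ioo 0 T) :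
    IsLocalExtr f t ↔ t = t₀ := by
  have hI : t₀ ∈ Set.Ico 0 T := Set.Ioo_subset_Ico_self ht₀
  constructor
  · intro h
    by_contra hne
    rcases lt_or_gt_of_ne hne with hlt' | hgt
    · have hsub : Set.Ioo 0 t₀ ⊆ Set.Ico 0 T := fun s hs => ⟨hs.1.le, hs.2.trans ht₀.2⟩
      refine not_isLocalExtr_of_strictMonoOn (a := 0) (b := t₀) ?_ ⟨ht.1, hlt'⟩ h
      refine (strictMonoOn_profile_of_half_le hκ (hanti.mono hsub) (fun s hs => hlt s (hsub hs))
        fun s hs => ?_).congr fun s hs => (hf s (hsub hs)).symm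
      exact hu₀ ▸ (hanti (hsub hs) hI hs.2).le
    · have hsub : Set.Ioo t₀ T ⊆ Set.Ico 0 T := fun s hs => ⟨(ht₀.1.trans hs.1).le, hs.2⟩
      refine not_isLocalExtr_of_strictAntiOn (a := t₀) (b := T) ?_ ⟨hgt, ht.2⟩ h
      refine (strictAntiOn_profile_of_le_half hκ (hanti.mono hsub) (fun s hs => hpos s (hsub hs))
        fun s hs => ?_).congr fun s hs => (hf s (hsub hs)).symm
      exact hu₀ ▸ (hanti hI (hsub hs) hs.1).le
  · rintro rfl
    -- At `t₀` the profile attains the maximum `1/4` of `u (1 - u)`.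
    refine Or.inr ?_
    filter_upwards [Ioo_mem_nhds ht.1 ht.2] with s hs
    have hs' := Set.Ioo_subset_Ico_self hs
    rw [hf s hs', hf t hI, hu₀]
    have h1 := hpos s hs'
    have h2 := hlt s hs'
    rw [abs_of_pos (mul_pos (by linarith) h1), abs_of_pos (by norm_num)]
    refine mul_le_mul_of_nonneg_left ?_ hκ.le
    nlinarith [sq_nonneg (u s - 1 / 2)]

end Profile

/-! ### Ricci flows of Berger metrics -/

theorem isRicciFlow_of_berger {F : Frame} (hF : F.IsMilnor) {T : ℝ} {g : ℝ → RiemannianMetric}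
    {A B : ℝ → ℝ} (hg : ∀ t ∈ Set.Ico 0 T, (g t).IsDiagonal F (A t) (B t) (B t))
    (hA : ContDiffOn ℝ ∞ A (Set.Ico 0 T)) (hB : ContDiffOn ℝ ∞ B (Set.Ico 0 T))
    (hA' : ∀ t ∈ Set.Ico 0 T, HasDerivAt A (-4 * (A t / B t) ^ 2) t)
    (hB' : ∀ t ∈ Set.Ico 0 T, HasDerivAt B (-8 + 4 * (A t / B t)) t) : IsRicciFlow F T g where
  smooth X Y := by
    refine ⟨fun p => A p.1 * (F.repr X 0 * F.repr Y 0) + B p.1 * (F.repr X 1 * F.repr Y 1)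
      + B p.1 * (F.repr X 2 * F.repr Y 2), ?_, fun t ht x => (hg t ht).form_apply x X Y⟩
    have hm : Set.MapsTo Prod.fst (Set.Ico 0 T ×ˢ (Set.univ : Set (Fin 2 → Fin 2 → ℂ)))
        (Set.Ico 0 T) := fun p hp => hp.1
    have h1 := hA.comp contDiffOn_fst hm
    have h2 := hB.comp contDiffOn_fst hm
    exact ((h1.mul contDiffOn_const).add (h2.mul contDiffOn_const)).add (h2.mul contDiffOn_const)
  evolution t ht x i j := by
    rw [(hg t ht).ricci_eq hF]
    have hcongr : ∀ s ∈ Set.Ico 0 T, (g s).form x (F i) (F j) =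
        Matrix.diagonal ![A s, B s, B s] i j := fun s hs => hg s hs x i j
    refine HasDerivWithinAt.congr (f := fun s => Matrix.diagonal ![A s, B s, B s] i j)
      ?_ hcongr (hcongr t ht)
    refine HasDerivAt.hasDerivWithinAt ?_
    have ha := hA' t ht
    have hb := hB' t ht
    have hz := hasDerivAt_const t (0 : ℝ)
    fin_cases i <;> fin_cases j <;> simp [Matrix.diagonal, hz]
    · exact ha.congr_deriv (by ring)
    · exact hb.congr_deriv (by ring)
    · exact hb.congr_deriv (by ring)

/-- A Ricci flow of diagonal metrics whose first coefficient tends to zero cannot be continued. -/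
theorem not_isRicciFlow_of_collapse {F : Frame} {T T' : ℝ} {g g' : ℝ → RiemannianMetric}
    {A B : ℝ → ℝ} (hT : 0 < T) (hg : ∀ t ∈ Set.Ico 0 T, (g t).IsDiagonal F (A t) (B t) (B t))
    (hA : Filter.Tendsto A (𝓝[<] T) (𝓝 0)) (hT' : T < T') (hg' : IsRicciFlow F T' g') :
    ¬ ∀ t ∈ Set.Ico 0 T, g' t = g t := by
  intro heq
  have hTm : T ∈ Set.Ico 0 T' := ⟨hT.le, hT'⟩
  have hmem : Set.Ico 0 T ∈ 𝓝[<] T := Ico_mem_nhdsLT hT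
  -- An extension is continuous at `T`, so its first coefficient there would equal the limit `0` of
  -- `A`, against positivity.
  have hc := (hg'.evolution T hTm 1 0 0).continuousWithinAt
  have hle : 𝓝[<] T ≤ 𝓝[Set.Ico 0 T'] T :=
    nhdsWithin_le_of_mem (Filter.mem_of_superset hmem (Set.Ico_subset_Ico_right hT'.le))
  have hlim : Filter.Tendsto A (𝓝[<] T) (𝓝 ((g' T).form 1 (F 0) (F 0))) := by
    refine (hc.tendsto.mono_left hle).congr' ?_
    filter_upwards [hmem] with t ht
    rw [heq t ht, hg t ht 1 0 0]
    rfl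
  exact ((g' T).pos 1 (F 0) (F.ne_zero 0)).ne' (tendsto_nhds_unique hlim hA)

end CottonFlow

end

/-! ### Proof of the main theorem -/

open CottonFlow in
theorem theorem3p2 (F : Frame) (hF : F.IsMilnor) (g₀ : RiemannianMetric) (A₀ B₀ C₀ : ℝ)
    (hg₀ : g₀.IsDiagonal F A₀ B₀ C₀) (hBC : B₀ = C₀) :
    ∃ (T : ℝ) (g : ℝ → RiemannianMetric) (A B : ℝ → ℝ),
      0 < T ∧ g 0 = g₀ ∧ IsMaximalRicciFlow F T g ∧
      (∀ t ∈ Set.Ico 0 T, (g t).LeftInvariant ∧ (g t).IsDiagonal F (A t) (B t) (B t)) ∧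
      (∀ (T' : ℝ) (g' : ℝ → RiemannianMetric), g' 0 = g₀ → IsRicciFlow F T' g' →
        (∀ t ∈ Set.Ico 0 T', (g' t).LeftInvariant) →
        T' ≤ T ∧ ∀ t ∈ Set.Ico 0 T', g' t = g t) ∧
      (A₀ / B₀ < 1 / 2 →
        (∃ t₀ ∈ Set.Ioo 0 T, (∀ t ∈ Set.Ico 0 T, A t / B t = 1 / 2 ↔ t = t₀) ∧
          ∀ t ∈ Set.Ioo 0 T, IsLocalExtr (fun s => cottonL1 F (g s)) t ↔ t = t₀) ∧
        Filter.Tendsto (fun t => cottonL1 F (g t)) (nhdsWithin T (Set.Iio T)) (nhds 0)) ∧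
      ((1 / 2 ≤ A₀ / B₀ ∧ A₀ / B₀ < 1) ∨ 1 < A₀ / B₀ →
        StrictAntiOn (fun t => cottonL1 F (g t)) (Set.Ico 0 T) ∧
        Filter.Tendsto (fun t => cottonL1 F (g t)) (nhdsWithin T (Set.Iio T)) (nhds 0)) ∧
      (A₀ = B₀ → ∀ t ∈ Set.Ico 0 T, cottonL1 F (g t) = 0) := by
  subst hBC
  have hA₀ := hg₀.fst_pos
  have hB₀ := hg₀.snd_pos
  -- The initial value of the conserved quantity `(1 - A / B) / A²`.
  obtain ⟨σ, hσ⟩ : ∃ σ : ℝ, 1 - σ * A₀ ^ 2 = A₀ / B₀ :=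
    ⟨(1 - A₀ / B₀) / A₀ ^ 2, by field_simp; ring⟩
  have hr₀ : 0 < 1 - σ * A₀ ^ 2 := hσ ▸ div_pos hA₀ hB₀
  obtain ⟨T, hT, A, hA0, hAT, hAc, hAanti, hAsm, hA'⟩ := exists_berger_profile hA₀ hr₀
  set u : ℝ → ℝ := fun t => σ * A t ^ 2 with hu
  -- `B` is recovered from the conservation law `A / B = 1 - u`; its evolution equation follows from
  -- that of `A`.
  set B : ℝ → ℝ := fun t => A t / (1 - u t) with hB
  have hApos : ∀ t ∈ Set.Ico 0 T, 0 < A t := fun t ht => hAT ▸ hAanti ht.2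
  have hsq : StrictAntiOn (fun t => A t ^ 2) (Set.Ico 0 T) := fun s hs t ht hst =>
    pow_lt_pow_left₀ (hAanti hst) (hApos t ht).le two_ne_zero
  have h0 : (0 : ℝ) ∈ Set.Ico 0 T := ⟨le_rfl, hT⟩
  have hu0 : 1 - u 0 = A₀ / B₀ := by simp only [hu, hA0, hσ]
  have hr : ∀ t ∈ Set.Ico 0 T, 0 < 1 - u t := by
    intro t ht
    have h1 : A t ^ 2 ≤ A₀ ^ 2 := hA0 ▸ hsq.antitoneOn h0 ht ht.1
    have h2 := sq_nonneg (A t)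
    simp only [hu]
    rcases le_total σ 0 with h | h <;> nlinarith
  have hBpos : ∀ t ∈ Set.Ico 0 T, 0 < B t := fun t ht => div_pos (hApos t ht) (hr t ht)
  have hratio : ∀ t ∈ Set.Ico 0 T, A t / B t = 1 - u t := fun t ht =>
    div_div_cancel₀ (hApos t ht).ne'
  have hB' : ∀ t ∈ Set.Ico 0 T, HasDerivAt B (-8 + 4 * (A t / B t)) t := by
    intro t ht
    have hrt := (hr t ht).ne'
    have h := (hA' t ht).div ((((hA' t ht).pow 2).const_mul σ).const_sub 1) hrt
    refine h.congr_deriv ?_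
    rw [hratio t ht]
    simp only [hu, Pi.pow_apply] at hrt ⊢
    field_simp
    ring
  -- The default `g₀` is never used on `[0, T)`, where both coefficients are positive.
  set g : ℝ → RiemannianMetric := fun t =>
    if h : 0 < A t ∧ 0 < B t then bergerMetric F (A t) (B t) h.1 h.2 else g₀ with hgdef
  have hdiag : ∀ t ∈ Set.Ico 0 T, (g t).IsDiagonal F (A t) (B t) (B t) := by
    intro t ht
    simp only [hgdef, dif_pos (And.intro (hApos t ht) (hBpos t ht))]
    exact bergerMetric_isDiagonal F _ _
  have hg0 : g 0 = g₀ := by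
    have hB0 : B 0 = B₀ := by
      simp only [hB, hu0, hA0]
      exact div_div_cancel₀ hA₀.ne'
    have h := hdiag 0 h0
    rw [hA0, hB0] at h
    exact h.eq hg₀
  have husm : ContDiffOn ℝ ∞ (fun t => 1 - u t) (Set.Ico 0 T) :=
    contDiffOn_const.sub (contDiffOn_const.mul (hAsm.pow 2))
  have hflow : IsRicciFlow F T g := isRicciFlow_of_berger hF hdiag hAsm
    (hAsm.div husm fun t ht => (hr t ht).ne') (fun t ht => by rw [hratio t ht]; exact hA' t ht) hB'
  have hAlim : Filter.Tendsto A (𝓝[<] T) (𝓝 0) :=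
    (hAT ▸ hAc.tendsto T : Filter.Tendsto A (𝓝 T) (𝓝 0)).mono_left nhdsWithin_le_nhds
  have hκ := cottonConst_pos F
  have hcot : ∀ t ∈ Set.Ico 0 T, cottonL1 F (g t) = cottonConst F * |(1 - u t) * u t| := by
    intro t ht
    rw [(hdiag t ht).cottonL1_eq hF, hratio t ht, sub_sub_cancel]
  have hlim : Filter.Tendsto (fun t => cottonL1 F (g t)) (𝓝[<] T) (𝓝 0) := by
    have hc : Filter.Tendsto (fun t => cottonConst F * |(1 - u t) * u t|) (𝓝[<] T) (𝓝 0) := by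
      have hul : Filter.Tendsto u (𝓝[<] T) (𝓝 0) := by
        simpa using (hAlim.pow 2).const_mul σ
      simpa using (((hul.const_sub 1).mul hul).abs).const_mul (cottonConst F)
    refine hc.congr' ?_
    filter_upwards [Ico_mem_nhdsLT hT] with t ht
    exact (hcot t ht).symm
  have huanti : 0 < σ → StrictAntiOn u (Set.Ico 0 T) := fun hσ s hs t ht hst =>
    mul_lt_mul_of_pos_left (hsq hs ht hst) hσ
  have hupos : 0 < σ → ∀ t ∈ Set.Ico 0 T, 0 < u t := fun hσ t ht =>
    mul_pos hσ (pow_pos (hApos t ht) 2)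
  have hσpos : A₀ / B₀ < 1 → 0 < σ := fun h => by
    by_contra hn
    nlinarith [sq_nonneg A₀]
  refine ⟨T, g, A, B, hT, hg0, ⟨hflow, fun T' hT' g' hg' =>
    not_isRicciFlow_of_collapse hT hdiag hAlim hT' hg'⟩,
    fun t ht => ⟨(hdiag t ht).leftInvariant, hdiag t ht⟩, ?_, ?_, ?_, ?_⟩
  · intro T' g' hg'0 hg' hinv'
    have key : ∀ S, S ≤ T → S ≤ T' → ∀ t ∈ Set.Ico 0 S, g' t = g t := fun S h h' t ht =>
      (hg'.mono h').eq_of_leftInvariant (fun s hs => hinv' s (Set.Ico_subset_Ico_right h' hs))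
        (hflow.mono h) (fun s hs => (hdiag s (Set.Ico_subset_Ico_right h hs)).leftInvariant)
        (hg'0.trans hg0.symm) ht
    -- If `T < T'`, then `g'` agrees with `g` up to `T` by uniqueness and so continues it past the
    -- collapse.
    have hle : T' ≤ T := by
      by_contra hlt
      push Not at hlt
      exact not_isRicciFlow_of_collapse hT hdiag hAlim hlt hg' (key T le_rfl hlt.le)
    exact ⟨hle, key T' hle le_rfl⟩
  · intro h
    have hσ' := hσpos (by linarith)
    have huc : Continuous u := continuous_const.mul (hAc.pow 2)
    -- Here `u 0 = 1 - A₀ / B₀ > 1/2` and `u T = 0`, so the crossing lies strictly inside.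
    obtain ⟨t₀, ht₀, hut₀⟩ : (1 / 2 : ℝ) ∈ u '' Set.Ioo 0 T :=
      intermediate_value_Ioo' hT.le huc.continuousOn ⟨by simp [hu, hAT], by linarith⟩
    refine ⟨⟨t₀, ht₀, fun t ht => ?_, fun t ht => ?_⟩, hlim⟩
    · rw [hratio t ht]
      constructor
      · intro h
        exact (huanti hσ').injOn ht (Set.Ioo_subset_Ico_self ht₀) (by linarith)
      · rintro rfl
        linarith
    · exact isLocalExtr_profile_iff hκ (huanti hσ') (hupos hσ') (fun s hs => by linarith [hr s hs])
        ht₀ hut₀ hcot ht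
  · intro h
    refine ⟨StrictAntiOn.congr ?_ fun t ht => (hcot t ht).symm, hlim⟩
    rcases h with ⟨h1, h2⟩ | h
    · have hσ' := hσpos h2
      refine strictAntiOn_profile_of_le_half hκ (huanti hσ') (hupos hσ') fun t ht => ?_
      have := (huanti hσ').antitoneOn h0 ht ht.1
      linarith
    · have hσ' : σ < 0 := by
        by_contra hn
        nlinarith [sq_nonneg A₀]
      exact strictAntiOn_profile_of_neg hκ
        (fun s hs t ht hst => mul_lt_mul_of_neg_left (hsq hs ht hst) hσ')
        fun t ht => mul_neg_of_neg_of_pos hσ' (pow_pos (hApos t ht) 2)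
  · intro h t ht
    have hσ0 : σ = 0 := by
      rw [h, div_self hB₀.ne'] at hσ
      have : σ * B₀ ^ 2 = 0 := by linarith
      simpa [hB₀.ne'] using this
    rw [hcot t ht]
    simp [hu, hσ0]
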